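/- Let $N\ge 1$ and let $z_1,\dots,z_N$ be independent, almost surely nonnegative real random variables on a common probability space, with cumulative distribution functions $F_n(z)=\Pr(z_n\le z)$. Call a function $H:(0,\infty)\to(0,\infty)$ slowly varying at $0$ if $\lim_{x\to0^+}H(tx)/H(x)=1$ for every $t>0$, and regularly varying at $0$ with exponent $m$ (where $m\in\mathbb{R}$, $m\neq0$) if $\lim_{x\to0^+}H(tx)/H(x)=t^m$ for every $t>0$. Suppose that for each $n$ there are $d_n\in(0,\infty)$ and a function $l_n$, slowly varying at $0$, such that $F_n(z)=z^{d_n}l_n(z)$ for all $z>0$. Let $z_{\rm c}=\sum_{n=1}^N z_n$, with cumulative distribution function $F_{\rm c}$. Then, as $z\to0^+$, $$F_{\rm c}(z)\sim\Big[\Gamma\Big(\sum_{n=1}^N d_n+1\Big)\Big]^{-1}\prod_{n=1}^N\Gamma(d_n+1)\cdot\prod_{n=1}^N F_n(z),$$ meaning that the ratio of the two sides tends to $1$. Moreover, $F_{\rm c}$ is positive on $(0,\infty)$ and regularly varying at $0$ with exponent $\sum_{n=1}^N d_n$. -/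

import Mathlib

open Filter Topology MeasureTheory ProbabilityTheory

/-- A function `H : (0, ∞) → (0, ∞)` (given as the restriction of a function on `ℝ`) has finite
variation exponent `m` at `0`: for every `t > 0`, `H (t x) / H x → t ^ m` as `x ↓ 0`. -/
def HasVariationExponentAtZero (H : ℝ → ℝ) (m : ℝ) : Prop :=
  (∀ x : ℝ, 0 < x → 0 < H x) ∧
    ∀ t : ℝ, 0 < t → Tendsto (fun x : ℝ => H (t * x) / H x) (𝓝[>] 0) (𝓝 (t ^ m))

/-- `H` is slowly varying at `0`: its variation exponent there is `0`. -/
def IsSlowlyVaryingAtZero (H : ℝ → ℝ) : Prop :=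
  HasVariationExponentAtZero H 0

/-- `H` is regularly varying at `0` with exponent `m`, where `0 < |m| < ∞`. -/
def IsRegularlyVaryingAtZero (H : ℝ → ℝ) (m : ℝ) : Prop :=
  m ≠ 0 ∧ HasVariationExponentAtZero H m

/-! For independent nonnegative X, Y with distribution functions F, G, Pr(X + Y ≤ x) = ∫ G(x - y)
dF(y). Put y = ux and divide by F(x)G(x): since F(ux)/F(x) → u^a and G((1-u)x)/G(x) → (1-u)^b, the
limit should be ∫ (1-u)^b d(u^a) over [0, 1], a Beta integral. No uniform convergence is needed. For
fixed k, monotonicity traps the left side between two finite Stieltjes sums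
(`convolutionSum_le_cdf_add`, `cdf_add_le_convolutionSum`); these converge termwise
(`tendsto_convolutionSum`), and their limits enclose the integral with arbitrarily small gap
(`exists_convolutionSum_rpow_sub_le`). The resulting equivalence makes X + Y regularly varying
again, so induction on the number of summands applies. -/

/-- The Riemann–Stieltjes sum of `∫ G (1 - u) dF u` over `[0, 1]` cut into `k` equal parts, the
integrand being evaluated at the left endpoints if `e = 0` and at the right ones if `e = 1`. -/
noncomputable def convolutionSum (F G : ℝ → ℝ) (k : ℕ) (e : ℝ) : ℝ :=
  ∑ i ∈ Finset.range k, (F (((i + 1 : ℕ) : ℝ) / k) - F ((i : ℝ) / k)) * G (1 - (i + e) / k)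

/-! ### The Beta integral and its Stieltjes sums -/

theorem integral_mul_rpow_mul_one_sub_rpow {a b : ℝ} (ha : 0 < a) (hb : 0 < b) :
    ∫ u in (0 : ℝ)..1, (a * u ^ (a - 1)) * (1 - u) ^ b =
      Real.Gamma (a + 1) * Real.Gamma (b + 1) / Real.Gamma (a + b + 1) := by
  have h := beta_eq_betaIntegralReal a (b + 1) ha (by linarith)
  have h2 : Complex.betaIntegral a ((b + 1 : ℝ) : ℂ)
      = ((∫ u in (0 : ℝ)..1, u ^ (a - 1) * (1 - u) ^ b : ℝ) : ℂ) := by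
    rw [Complex.betaIntegral, ← intervalIntegral.integral_ofReal]
    refine intervalIntegral.integral_congr fun u hu => ?_
    rw [Set.uIcc_of_le zero_le_one] at hu
    have h1 : (0 : ℝ) ≤ 1 - u := by linarith [hu.2]
    simp only [Complex.ofReal_mul, Complex.ofReal_cpow hu.1, Complex.ofReal_cpow h1]
    push_cast
    ring_nf
  rw [h2, Complex.ofReal_re, beta] at h
  simp_rw [mul_assoc]
  rw [intervalIntegral.integral_const_mul, ← h, Real.Gamma_add_one ha.ne', ← add_assoc]
  ring

theorem intervalIntegrable_mul_rpow_sub_one {a : ℝ} (ha : 0 < a) (x y : ℝ) :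
    IntervalIntegrable (fun u : ℝ => a * u ^ (a - 1)) volume x y :=
  (intervalIntegral.intervalIntegrable_rpow' (by linarith)).const_mul a

theorem continuous_one_sub_rpow {b : ℝ} (hb : 0 < b) : Continuous fun u : ℝ => (1 - u) ^ b :=
  (continuous_const.sub continuous_id).rpow_const fun _ => Or.inr hb.le

theorem intervalIntegrable_mul_rpow_mul_one_sub_rpow {a b : ℝ} (ha : 0 < a) (hb : 0 < b)
    (x y : ℝ) :
    IntervalIntegrable (fun u : ℝ => (a * u ^ (a - 1)) * (1 - u) ^ b) volume x y :=
  (intervalIntegrable_mul_rpow_sub_one ha x y).mul_continuousOn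
    (continuous_one_sub_rpow hb).continuousOn

theorem integral_mul_rpow_sub_one {a : ℝ} (ha : 0 < a) (x y : ℝ) :
    ∫ u in x..y, a * u ^ (a - 1) = y ^ a - x ^ a := by
  rw [intervalIntegral.integral_const_mul, integral_rpow (Or.inl (by linarith)), sub_add_cancel]
  field_simp

theorem integral_eq_sum_range_div {f : ℝ → ℝ} (hf : ∀ x y, IntervalIntegrable f volume x y)
    {k : ℕ} (hk : 0 < k) :
    ∫ u in (0 : ℝ)..1, f u =
      ∑ i ∈ Finset.range k, ∫ u in ((i : ℝ) / k)..(((i + 1 : ℕ) : ℝ) / k), f u := by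
  have hk' : (k : ℝ) ≠ 0 := by positivity
  rw [intervalIntegral.sum_integral_adjacent_intervals (a := fun i : ℕ => (i : ℝ) / k)
    fun i _ => hf _ _]
  simp [hk']

theorem node_bounds {i k : ℕ} (hi : i ∈ Finset.range k) :
    0 ≤ (i : ℝ) / k ∧ (i : ℝ) / k ≤ ((i + 1 : ℕ) : ℝ) / k ∧ ((i + 1 : ℕ) : ℝ) / k ≤ 1 := by
  have h : i + 1 ≤ k := Finset.mem_range.1 hi
  have h' : ((i + 1 : ℕ) : ℝ) ≤ k := by exact_mod_cast h
  refine ⟨by positivity, by gcongr; simp, ?_⟩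
  exact div_le_one_of_le₀ h' (by positivity)

theorem integral_le_convolutionSum_rpow {a b : ℝ} (ha : 0 < a) (hb : 0 < b) {k : ℕ}
    (hk : 0 < k) :
    ∫ u in (0 : ℝ)..1, (a * u ^ (a - 1)) * (1 - u) ^ b ≤
      convolutionSum (fun u => u ^ a) (fun u => u ^ b) k 0 := by
  rw [integral_eq_sum_range_div (intervalIntegrable_mul_rpow_mul_one_sub_rpow ha hb) hk]
  refine Finset.sum_le_sum fun i hi => ?_
  obtain ⟨h0, h1, h2⟩ := node_bounds hi
  rw [← integral_mul_rpow_sub_one ha, ← intervalIntegral.integral_mul_const, add_zero]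
  refine intervalIntegral.integral_mono_on h1
    (intervalIntegrable_mul_rpow_mul_one_sub_rpow ha hb _ _)
    ((intervalIntegrable_mul_rpow_sub_one ha _ _).mul_const _) fun u hu => ?_
  have hu0 : 0 ≤ u := h0.trans hu.1
  have hu1 : 0 ≤ 1 - u := by linarith [hu.2]
  have := hu.1
  dsimp only
  gcongr

theorem convolutionSum_rpow_le_integral {a b : ℝ} (ha : 0 < a) (hb : 0 < b) {k : ℕ}
    (hk : 0 < k) :
    convolutionSum (fun u => u ^ a) (fun u => u ^ b) k 1 ≤
      ∫ u in (0 : ℝ)..1, (a * u ^ (a - 1)) * (1 - u) ^ b := by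
  rw [integral_eq_sum_range_div (intervalIntegrable_mul_rpow_mul_one_sub_rpow ha hb) hk]
  refine Finset.sum_le_sum fun i hi => ?_
  obtain ⟨h0, h1, h2⟩ := node_bounds hi
  rw [← integral_mul_rpow_sub_one ha, ← intervalIntegral.integral_mul_const]
  refine intervalIntegral.integral_mono_on h1
    ((intervalIntegrable_mul_rpow_sub_one ha _ _).mul_const _)
    (intervalIntegrable_mul_rpow_mul_one_sub_rpow ha hb _ _) fun u hu => ?_
  have hu0 : 0 ≤ u := h0.trans hu.1
  have hu1 : 0 ≤ 1 - ((i + 1 : ℕ) : ℝ) / k := by linarith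
  have := hu.2
  push_cast at this hu1
  dsimp only
  gcongr

/-- The gap is an average of the increments of (1-u)^b over the cells, weighted by the increments of
u^a, which sum to 1; uniform continuity makes it small. -/
theorem exists_convolutionSum_rpow_sub_le {a b ε : ℝ} (ha : 0 < a) (hb : 0 < b) (hε : 0 < ε) :
    ∃ k : ℕ, 0 < k ∧ convolutionSum (fun u => u ^ a) (fun u => u ^ b) k 0 -
      convolutionSum (fun u => u ^ a) (fun u => u ^ b) k 1 ≤ ε := by
  obtain ⟨δ, hδ, H⟩ := Metric.uniformContinuousOn_iff.1
    ((isCompact_Icc (a := (0 : ℝ)) (b := 1)).uniformContinuousOn_of_continuous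
      (continuous_one_sub_rpow hb).continuousOn) ε hε
  obtain ⟨n, hn⟩ := exists_nat_one_div_lt hδ
  refine ⟨n + 1, n.succ_pos, ?_⟩
  have hsum : ∑ i ∈ Finset.range (n + 1), ((((i + 1 : ℕ) : ℝ) / (n + 1 : ℕ)) ^ a -
      ((i : ℝ) / (n + 1 : ℕ)) ^ a) = 1 := by
    rw [Finset.sum_range_sub fun i : ℕ => ((i : ℝ) / (n + 1 : ℕ)) ^ a]
    have : ((n + 1 : ℕ) : ℝ) ≠ 0 := by positivity
    rw [div_self this]
    simp [ha.ne']
  rw [convolutionSum, convolutionSum, ← Finset.sum_sub_distrib]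
  calc _ ≤ ∑ i ∈ Finset.range (n + 1), ((((i + 1 : ℕ) : ℝ) / (n + 1 : ℕ)) ^ a -
      ((i : ℝ) / (n + 1 : ℕ)) ^ a) * ε := by
        refine Finset.sum_le_sum fun i hi => ?_
        obtain ⟨h0, h1, h2⟩ := node_bounds hi
        rw [← mul_sub]
        refine mul_le_mul_of_nonneg_left ?_ (sub_nonneg.2 (by gcongr))
        have h := H _ ⟨h0, h1.trans h2⟩ _ ⟨h0.trans h1, h2⟩ (by
          rw [dist_comm, Real.dist_eq, abs_of_nonneg (sub_nonneg.2 h1), ← sub_div]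
          push_cast
          simpa using hn)
        rw [Real.dist_eq] at h
        have := (le_abs_self _).trans h.le
        simpa using this
    _ = ε := by rw [← Finset.sum_mul, hsum, one_mul]

/-! ### Limits of the rescaled sums -/

/-- Extension of the limit defining the variation exponent to `t = 0`. -/
theorem HasVariationExponentAtZero.tendsto_of_nonneg {H : ℝ → ℝ} {a : ℝ}
    (h : HasVariationExponentAtZero H a) (ha : 0 < a) (h0 : H 0 = 0) {t : ℝ} (ht : 0 ≤ t) :
    Tendsto (fun x => H (t * x) / H x) (𝓝[>] 0) (𝓝 (t ^ a)) := by
  rcases ht.eq_or_lt with rfl | ht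
  · simp [h0, ha.ne']
  · exact h.2 t ht

theorem tendsto_convolutionSum {F G : ℝ → ℝ} {a b : ℝ} (hF : HasVariationExponentAtZero F a)
    (hG : HasVariationExponentAtZero G b) (ha : 0 < a) (hb : 0 < b) (hF0 : F 0 = 0)
    (hG0 : G 0 = 0) (k : ℕ) {e : ℝ} (he : e ≤ 1) :
    Tendsto (fun x => convolutionSum (fun u => F (u * x)) (fun u => G (u * x)) k e / (F x * G x))
      (𝓝[>] 0) (𝓝 (convolutionSum (fun u => u ^ a) (fun u => u ^ b) k e)) := by
  simp only [convolutionSum, Finset.sum_div, mul_div_mul_comm, sub_div]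
  refine tendsto_finsetSum _ fun i hi => ?_
  obtain ⟨h0, h1, h2⟩ := node_bounds hi
  refine ((hF.tendsto_of_nonneg ha hF0 (h0.trans h1)).sub
    (hF.tendsto_of_nonneg ha hF0 h0)).mul (hG.tendsto_of_nonneg hb hG0 ?_)
  -- The bound e ≤ 1 keeps the argument of G nonnegative.
  refine sub_nonneg.2 (le_trans ?_ h2)
  push_cast
  gcongr

theorem tendsto_of_convolutionSum_bounds {F G C : ℝ → ℝ} {a b : ℝ}
    (hF : HasVariationExponentAtZero F a) (hG : HasVariationExponentAtZero G b)
    (ha : 0 < a) (hb : 0 < b) (hF0 : F 0 = 0) (hG0 : G 0 = 0)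
    (hlow : ∀ k : ℕ, 0 < k → ∀ x : ℝ, 0 < x →
      convolutionSum (fun u => F (u * x)) (fun u => G (u * x)) k 1 ≤ C x)
    (hupp : ∀ k : ℕ, 0 < k → ∀ x : ℝ, 0 < x →
      C x ≤ convolutionSum (fun u => F (u * x)) (fun u => G (u * x)) k 0) :
    Tendsto (fun x => C x / (F x * G x)) (𝓝[>] 0)
      (𝓝 (Real.Gamma (a + 1) * Real.Gamma (b + 1) / Real.Gamma (a + b + 1))) := by
  rw [← integral_mul_rpow_mul_one_sub_rpow ha hb]
  refine tendsto_order.2 ⟨fun c hc => ?_, fun c hc => ?_⟩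
  -- The integral is at most the upper sum, so a gap of half its distance to c leaves the lower sum
  -- strictly above c.
  · obtain ⟨k, hk, hkε⟩ := exists_convolutionSum_rpow_sub_le ha hb (half_pos (sub_pos.2 hc))
    have h1 := integral_le_convolutionSum_rpow ha hb hk
    filter_upwards [(tendsto_order.1 (tendsto_convolutionSum hF hG ha hb hF0 hG0 k le_rfl)).1 c
      (by linarith), self_mem_nhdsWithin] with x hx hx0
    have := mul_pos (hF.1 x hx0) (hG.1 x hx0)
    exact hx.trans_le (div_le_div_of_nonneg_right (hlow k hk x hx0) this.le)
  · obtain ⟨k, hk, hkε⟩ := exists_convolutionSum_rpow_sub_le ha hb (half_pos (sub_pos.2 hc))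
    have h1 := convolutionSum_rpow_le_integral ha hb hk
    filter_upwards [(tendsto_order.1
      (tendsto_convolutionSum hF hG ha hb hF0 hG0 k zero_le_one)).2 c
      (by linarith), self_mem_nhdsWithin] with x hx hx0
    have := mul_pos (hF.1 x hx0) (hG.1 x hx0)
    exact (div_le_div_of_nonneg_right (hupp k hk x hx0) this.le).trans_lt hx

/-! ### Variation exponents -/

theorem tendsto_const_mul_nhdsGT_zero {t : ℝ} (ht : 0 < t) :
    Tendsto (fun x : ℝ => t * x) (𝓝[>] 0) (𝓝[>] 0) := by
  refine tendsto_nhdsWithin_iff.2 ⟨?_, ?_⟩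
  · have : Tendsto (fun x : ℝ => t * x) (𝓝 0) (𝓝 (t * 0)) := tendsto_id.const_mul t
    rw [mul_zero] at this
    exact this.mono_left nhdsWithin_le_nhds
  · filter_upwards [self_mem_nhdsWithin] with x hx
    exact mul_pos ht hx

theorem HasVariationExponentAtZero.mul {F G : ℝ → ℝ} {a b : ℝ}
    (hF : HasVariationExponentAtZero F a) (hG : HasVariationExponentAtZero G b) :
    HasVariationExponentAtZero (fun x => F x * G x) (a + b) := by
  refine ⟨fun x hx => mul_pos (hF.1 x hx) (hG.1 x hx), fun t ht => ?_⟩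
  rw [Real.rpow_add ht]
  exact ((hF.2 t ht).mul (hG.2 t ht)).congr fun x => (mul_div_mul_comm _ _ _ _).symm

theorem HasVariationExponentAtZero.of_tendsto_div {F C : ℝ → ℝ} {a c : ℝ}
    (hF : HasVariationExponentAtZero F a) (hC : ∀ x, 0 < x → 0 < C x) (hc : c ≠ 0)
    (h : Tendsto (fun x => C x / F x) (𝓝[>] 0) (𝓝 c)) : HasVariationExponentAtZero C a := by
  refine ⟨hC, fun t ht => ?_⟩
  have h1 := ((h.comp (tendsto_const_mul_nhdsGT_zero ht)).div h hc).mul (hF.2 t ht)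
  rw [div_self hc, one_mul] at h1
  refine h1.congr' ?_
  filter_upwards [self_mem_nhdsWithin] with x hx
  have h2 := (hF.1 x hx).ne'
  have h3 := (hF.1 _ (mul_pos ht hx)).ne'
  have h4 := (hC x hx).ne'
  show C (t * x) / F (t * x) / (C x / F x) * (F (t * x) / F x) = C (t * x) / C x
  field_simp

theorem hasVariationExponentAtZero_rpow (a : ℝ) : HasVariationExponentAtZero (fun x => x ^ a) a := by
  refine ⟨fun x hx => Real.rpow_pos_of_pos hx a, fun t ht => tendsto_const_nhds.congr' ?_⟩
  filter_upwards [self_mem_nhdsWithin] with x hx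
  rw [Real.mul_rpow ht.le (le_of_lt hx), mul_div_cancel_right₀ _ (Real.rpow_pos_of_pos hx a).ne']

theorem HasVariationExponentAtZero.congr {F G : ℝ → ℝ} {a : ℝ}
    (hF : HasVariationExponentAtZero F a) (h : ∀ x, 0 < x → G x = F x) :
    HasVariationExponentAtZero G a := by
  refine ⟨fun x hx => h x hx ▸ hF.1 x hx, fun t ht => (hF.2 t ht).congr' ?_⟩
  filter_upwards [self_mem_nhdsWithin] with x hx
  rw [h x hx, h _ (mul_pos ht hx)]

/-- No atom at 0: as F(x) ≤ 1, F(0) ≤ F(tx)/F(x) → t^a, and then t ↓ 0. -/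
theorem HasVariationExponentAtZero.cdf_zero {μ : Measure ℝ} {a : ℝ}
    (h : HasVariationExponentAtZero (cdf μ) a) (ha : 0 < a) : cdf μ 0 = 0 := by
  refine le_antisymm ?_ (cdf_nonneg μ 0)
  have h1 : ∀ t : ℝ, 0 < t → cdf μ 0 ≤ t ^ a := fun t ht => by
    refine ge_of_tendsto (h.2 t ht) ?_
    filter_upwards [self_mem_nhdsWithin] with x hx
    rw [le_div_iff₀ (h.1 x hx)]
    calc cdf μ 0 * cdf μ x ≤ cdf μ 0 := mul_le_of_le_one_right (cdf_nonneg μ 0) (cdf_le_one μ x)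
      _ ≤ _ := (cdf μ).mono (mul_pos ht hx).le
  have h2 : Tendsto (fun t : ℝ => t ^ a) (𝓝[>] 0) (𝓝 0) := by
    have := (Real.continuousAt_rpow_const 0 a (Or.inr ha.le)).tendsto
    rw [Real.zero_rpow ha.ne'] at this
    exact this.mono_left nhdsWithin_le_nhds
  refine ge_of_tendsto h2 ?_
  filter_upwards [self_mem_nhdsWithin] with t ht using h1 t ht

/-! ### Sums of independent random variables -/

section Probability

variable {Ω : Type*} [MeasurableSpace Ω] {P : Measure Ω} [IsProbabilityMeasure P] {X Y : Ω → ℝ}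

theorem cdf_map_eq_real (hX : Measurable X) (x : ℝ) :
    cdf (P.map X) x = P.real {ω | X ω ≤ x} := by
  have := Measure.isProbabilityMeasure_map (μ := P) hX.aemeasurable
  rw [cdf_eq_real, map_measureReal_apply hX measurableSet_Iic]
  rfl

theorem measureReal_Ioc_inter_Iic (hX : Measurable X) (hY : Measurable Y) (h : IndepFun X Y P)
    {x₁ x₂ : ℝ} (hx : x₁ ≤ x₂) (y : ℝ) :
    P.real {ω | (x₁ < X ω ∧ X ω ≤ x₂) ∧ Y ω ≤ y} =
      (cdf (P.map X) x₂ - cdf (P.map X) x₁) * cdf (P.map Y) y := by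
  have h1 := h.measure_inter_preimage_eq_mul (Set.Ioc x₁ x₂) (Set.Iic y) measurableSet_Ioc
    measurableSet_Iic
  have h2 : P.real {ω | x₁ < X ω ∧ X ω ≤ x₂} = cdf (P.map X) x₂ - cdf (P.map X) x₁ := by
    rw [cdf_map_eq_real hX, cdf_map_eq_real hX, ← measureReal_sdiff
      (show {ω | X ω ≤ x₁} ⊆ {ω | X ω ≤ x₂} from fun ω (hω : X ω ≤ x₁) => hω.trans hx)
      (measurableSet_le hX measurable_const)]
    congr 1
    ext ω
    simp [and_comm]
  rw [← h2, cdf_map_eq_real hY, measureReal_def, measureReal_def, measureReal_def,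
    ← ENNReal.toReal_mul]
  exact congrArg ENNReal.toReal h1

theorem convolutionSum_cdf_eq (hX : Measurable X) (hY : Measurable Y) (h : IndepFun X Y P)
    (k : ℕ) {x : ℝ} (hx : 0 < x) (e : ℝ) :
    convolutionSum (fun u => cdf (P.map X) (u * x)) (fun u => cdf (P.map Y) (u * x)) k e =
      ∑ i ∈ Finset.range k, P.real {ω | ((i : ℝ) / k * x < X ω ∧
        X ω ≤ ((i + 1 : ℕ) : ℝ) / k * x) ∧ Y ω ≤ (1 - (i + e) / k) * x} := by
  refine Finset.sum_congr rfl fun i hi => ?_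
  rw [measureReal_Ioc_inter_Iic hX hY h]
  have := (node_bounds hi).2.1
  gcongr

/-- By independence each term is the probability of (X, Y) lying in a strip; the strips are disjoint
and lie in the region X + Y ≤ x. -/
theorem convolutionSum_le_cdf_add (hX : Measurable X) (hY : Measurable Y) (h : IndepFun X Y P)
    (k : ℕ) {x : ℝ} (hx : 0 < x) :
    convolutionSum (fun u => cdf (P.map X) (u * x)) (fun u => cdf (P.map Y) (u * x)) k 1 ≤
      cdf (P.map (X + Y)) x := by
  rw [convolutionSum_cdf_eq hX hY h k hx, cdf_map_eq_real (hX.add hY),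
    ← measureReal_biUnion_finset]
  · refine measureReal_mono fun ω hω => ?_
    simp only [Set.mem_iUnion, Set.mem_ofPred_eq, exists_prop] at hω
    obtain ⟨i, -, ⟨-, h1⟩, h2⟩ := hω
    push_cast at h1
    show X ω + Y ω ≤ x
    linarith
  · intro i _ j _ hij
    refine Set.disjoint_left.2 fun ω h1 h2 => ?_
    obtain ⟨⟨h1, h1'⟩, -⟩ := h1
    obtain ⟨⟨h2, h2'⟩, -⟩ := h2
    have key : ∀ {m n : ℕ}, (m : ℝ) / k * x < ((n + 1 : ℕ) : ℝ) / k * x → m < n + 1 := by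
      intro m n hmn
      by_contra! hc
      have : ((n + 1 : ℕ) : ℝ) ≤ m := by exact_mod_cast hc
      exact absurd hmn (not_lt.2 (by gcongr))
    have := key (h1.trans_le h2')
    have := key (h2.trans_le h1')
    omega
  · intro i _
    exact ((measurableSet_lt measurable_const hX).inter
      (measurableSet_le hX measurable_const)).inter (measurableSet_le hY measurable_const)

theorem cdf_add_le_convolutionSum (hX : Measurable X) (hY : Measurable Y) (h : IndepFun X Y P)
    (hX0 : cdf (P.map X) 0 = 0) (hY0 : ∀ᵐ ω ∂P, 0 ≤ Y ω) {k : ℕ} (hk : 0 < k) {x : ℝ}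
    (hx : 0 < x) :
    cdf (P.map (X + Y)) x ≤
      convolutionSum (fun u => cdf (P.map X) (u * x)) (fun u => cdf (P.map Y) (u * x)) k 0 := by
  rw [convolutionSum_cdf_eq hX hY h k hx, cdf_map_eq_real (hX.add hY)]
  refine le_trans ?_ (measureReal_biUnion_finset_le _ _)
  -- The cells are open on the left, so X = 0 would escape the cover.
  have hXpos : ∀ᵐ ω ∂P, 0 < X ω := by
    rw [cdf_map_eq_real hX, measureReal_eq_zero_iff] at hX0
    rw [ae_iff]
    simpa using hX0
  have hk' : (0 : ℝ) < k := by positivity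
  refine ENNReal.toReal_mono (measure_ne_top _ _) (measure_mono_ae ?_)
  filter_upwards [hXpos, hY0] with ω h1 h2 h3
  have h3 : X ω + Y ω ≤ x := h3
  -- The half-open cell containing X has index one less than this ceiling.
  obtain ⟨i, hi⟩ : ∃ i, ⌈X ω * k / x⌉₊ = i + 1 :=
    Nat.exists_eq_succ_of_ne_zero (Nat.ceil_pos.2 (by positivity)).ne'
  have hub : X ω * k / x ≤ ((i + 1 : ℕ) : ℝ) := hi ▸ Nat.le_ceil _
  have hlb : (i : ℝ) < X ω * k / x := Nat.lt_ceil.1 (by omega)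
  rw [div_le_iff₀ hx] at hub
  rw [lt_div_iff₀ hx] at hlb
  have hlb' : (i : ℝ) / k * x < X ω := by
    rw [div_mul_eq_mul_div, div_lt_iff₀ hk']
    exact hlb
  refine Set.mem_biUnion (x := i) (Finset.mem_coe.2 (Finset.mem_range.2 ?_)) ⟨⟨hlb', ?_⟩, ?_⟩
  -- Here Y ≥ 0 enters: it gives X ≤ x, so the cell is among the first k.
  · have h4 : (i : ℝ) * x < k * x := hlb.trans_le (by rw [mul_comm]; gcongr; linarith)
    exact_mod_cast lt_of_mul_lt_mul_right h4 hx.le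
  · rw [div_mul_eq_mul_div, le_div_iff₀ hk']
    exact hub
  · rw [add_zero]
    linarith

theorem cdf_add_pos (hX : Measurable X) (hY : Measurable Y) (h : IndepFun X Y P)
    (hXpos : ∀ x, 0 < x → 0 < cdf (P.map X) x) (hYpos : ∀ x, 0 < x → 0 < cdf (P.map Y) x)
    (hX0 : cdf (P.map X) 0 = 0) {x : ℝ} (hx : 0 < x) : 0 < cdf (P.map (X + Y)) x := by
  -- With two cells, the first term of the lower sum is F(x/2)G(x/2) > 0.
  refine lt_of_lt_of_le ?_ (convolutionSum_le_cdf_add hX hY h 2 hx)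
  have h2 : 0 ≤ (cdf (P.map X) x - cdf (P.map X) (2⁻¹ * x)) * cdf (P.map Y) 0 :=
    mul_nonneg (sub_nonneg.2 ((cdf _).mono (by linarith))) (cdf_nonneg _ _)
  have h3 := mul_pos (hXpos (2⁻¹ * x) (by positivity)) (hYpos (2⁻¹ * x) (by positivity))
  have h4 : (1 : ℝ) - 2⁻¹ = 2⁻¹ := by norm_num
  have h5 : (1 : ℝ) + 1 = 2 := by norm_num
  simp [convolutionSum, Finset.sum_range_succ, hX0, h4, h5]
  linarith

/-- The distribution function of a sum of two independent nonnegative random variables whose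
distribution functions have positive variation exponents at `0`. -/
theorem tendsto_cdf_add_div (hX : Measurable X) (hY : Measurable Y) (h : IndepFun X Y P)
    (hY0 : ∀ᵐ ω ∂P, 0 ≤ Y ω) {a b : ℝ} (ha : 0 < a) (hb : 0 < b)
    (hF : HasVariationExponentAtZero (cdf (P.map X)) a)
    (hG : HasVariationExponentAtZero (cdf (P.map Y)) b) :
    Tendsto (fun x => cdf (P.map (X + Y)) x / (cdf (P.map X) x * cdf (P.map Y) x)) (𝓝[>] 0)
      (𝓝 (Real.Gamma (a + 1) * Real.Gamma (b + 1) / Real.Gamma (a + b + 1))) :=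
  tendsto_of_convolutionSum_bounds hF hG ha hb (hF.cdf_zero ha) (hG.cdf_zero hb)
    (fun k _ _ hx => convolutionSum_le_cdf_add hX hY h k hx)
    fun _ hk _ hx => cdf_add_le_convolutionSum hX hY h (hF.cdf_zero ha) hY0 hk hx

theorem cdf_sum_asymptotics {ι : Type*} {z : ι → Ω → ℝ} (hz_meas : ∀ n, Measurable (z n))
    (hz_nonneg : ∀ n, ∀ᵐ ω ∂P, 0 ≤ z n ω) (hz_indep : iIndepFun z P) {d : ι → ℝ}
    (hd : ∀ n, 0 < d n) (hF : ∀ n, HasVariationExponentAtZero (cdf (P.map (z n))) (d n))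
    {s : Finset ι} (hs : s.Nonempty) :
    Tendsto (fun x => cdf (P.map (∑ n ∈ s, z n)) x / ∏ n ∈ s, cdf (P.map (z n)) x) (𝓝[>] 0)
        (𝓝 ((∏ n ∈ s, Real.Gamma (d n + 1)) / Real.Gamma ((∑ n ∈ s, d n) + 1))) ∧
      HasVariationExponentAtZero (cdf (P.map (∑ n ∈ s, z n))) (∑ n ∈ s, d n) := by
  induction hs using Finset.Nonempty.cons_induction with
  | singleton i =>
    refine ⟨?_, by simpa using hF i⟩
    simp only [Finset.sum_singleton, Finset.prod_singleton]
    rw [div_self (Real.Gamma_pos_of_pos (by linarith [hd i])).ne']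
    refine tendsto_const_nhds.congr' ?_
    filter_upwards [self_mem_nhdsWithin] with x hx
    rw [div_self ((hF i).1 x hx).ne']
  | cons i s his hs ih =>
    obtain ⟨ih1, ih2⟩ := ih
    have hsum : 0 < ∑ n ∈ s, d n := Finset.sum_pos (fun n _ => hd n) hs
    have hSmeas : Measurable (∑ n ∈ s, z n) := by fun_prop
    have hSnonneg : ∀ᵐ ω ∂P, 0 ≤ (∑ n ∈ s, z n) ω := by
      filter_upwards [(Finset.eventually_all s).2 fun n _ => hz_nonneg n] with ω hω
      rw [Finset.sum_apply]
      exact Finset.sum_nonneg hω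
    have hind : IndepFun (z i) (∑ n ∈ s, z n) P :=
      (hz_indep.indepFun_finsetSum_of_notMem hz_meas his).symm
    have key := tendsto_cdf_add_div (hz_meas i) hSmeas hind hSnonneg (hd i) hsum (hF i) ih2
    have hΓ : ∀ {r : ℝ}, 0 < r → 0 < Real.Gamma (r + 1) := fun hr =>
      Real.Gamma_pos_of_pos (by linarith)
    have hpos : ∀ x, 0 < x → 0 < cdf (P.map (z i + ∑ n ∈ s, z n)) x := fun x hx =>
      cdf_add_pos (hz_meas i) hSmeas hind (hF i).1 ih2.1 ((hF i).cdf_zero (hd i)) hx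
    simp only [Finset.sum_cons, Finset.prod_cons]
    refine ⟨?_, ((hF i).mul ih2).of_tendsto_div hpos (div_pos (mul_pos (hΓ (hd i)) (hΓ hsum))
      (hΓ (add_pos (hd i) hsum))).ne' key⟩
    -- The Gamma factor of the partial sum cancels between the two limits.
    have h1 := key.mul ih1
    have h2 : Real.Gamma (d i + 1) * Real.Gamma (∑ n ∈ s, d n + 1) /
        Real.Gamma (d i + ∑ n ∈ s, d n + 1) *
        ((∏ n ∈ s, Real.Gamma (d n + 1)) / Real.Gamma (∑ n ∈ s, d n + 1)) =
        Real.Gamma (d i + 1) * (∏ n ∈ s, Real.Gamma (d n + 1)) /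
          Real.Gamma (d i + ∑ n ∈ s, d n + 1) := by
      have := (hΓ hsum).ne'
      field_simp
    rw [h2] at h1
    refine h1.congr' ?_
    filter_upwards [self_mem_nhdsWithin] with x hx
    have := (ih2.1 x hx).ne'
    field_simp

end Probability

theorem mainTheorem5 {Ω : Type*} [MeasurableSpace Ω] (P : Measure Ω) [IsProbabilityMeasure P]
    (N : ℕ) (hN : 1 ≤ N)
    (z : Fin N → Ω → ℝ) (hz_meas : ∀ n, Measurable (z n))
    (hz_nonneg : ∀ n, ∀ᵐ ω ∂P, 0 ≤ z n ω)
    (hz_indep : iIndepFun z P)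
    (d : Fin N → ℝ) (hd : ∀ n, 0 < d n)
    (l : Fin N → ℝ → ℝ) (hl : ∀ n, IsSlowlyVaryingAtZero (l n))
    (hF : ∀ n, ∀ x : ℝ, 0 < x → cdf (P.map (z n)) x = x ^ d n * l n x) :
    Tendsto
        (fun x : ℝ =>
          cdf (P.map (fun ω => ∑ n, z n ω)) x /
            ((Real.Gamma ((∑ n, d n) + 1))⁻¹ * (∏ n, Real.Gamma (d n + 1)) *
              ∏ n, cdf (P.map (z n)) x))
        (𝓝[>] 0) (𝓝 1) ∧
      IsRegularlyVaryingAtZero (cdf (P.map (fun ω => ∑ n, z n ω))) (∑ n, d n) := by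
  have hFv : ∀ n, HasVariationExponentAtZero (cdf (P.map (z n))) (d n) := fun n => by
    have h := (hasVariationExponentAtZero_rpow (d n)).mul (hl n)
    rw [add_zero] at h
    exact h.congr (hF n)
  have hne : (Finset.univ : Finset (Fin N)).Nonempty := ⟨⟨0, hN⟩, Finset.mem_univ _⟩
  obtain ⟨h1, h2⟩ := cdf_sum_asymptotics hz_meas hz_nonneg hz_indep hd hFv hne
  have hsum : 0 < ∑ n, d n := Finset.sum_pos (fun n _ => hd n) hne
  have hfun : (fun ω => ∑ n, z n ω) = ∑ n, z n := by
    ext ω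
    rw [Finset.sum_apply]
  rw [hfun]
  refine ⟨?_, hsum.ne', h2⟩
  set c := (∏ n, Real.Gamma (d n + 1)) / Real.Gamma ((∑ n, d n) + 1) with hc
  have hc0 : c ≠ 0 := (div_pos (Finset.prod_pos fun n _ =>
    Real.Gamma_pos_of_pos (by linarith [hd n])) (Real.Gamma_pos_of_pos (by linarith))).ne'
  have h3 := h1.div_const c
  rw [div_self hc0] at h3
  refine h3.congr fun x => ?_
  rw [div_div, hc]
  congr 1
  ring
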